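/- Let $\mathbb{F}$ be a field with a standard Borel structure for which addition and multiplication are measurable (for example a finite field, $\mathbb{R}$ or $\mathbb{C}$). A nested coset coding scheme over $\mathbb{F}$ consists of matrices $G^{\mathrm{enc}} \in \mathbb{F}^{m \times n}$ and $G^{\mathrm{sec}} \in \mathbb{F}^{k \times n}$ of full row rank whose row spaces intersect trivially; it shares a random secret $\mathbf{s} \in \mathbb{F}^m$ with a random noise vector $\mathbf{r} \in \mathbb{F}^k$ (of any distribution) as $\hat{\mathbf{s}} = \mathbf{s}G^{\mathrm{enc}} + \mathbf{r}G^{\mathrm{sec}} \in \mathbb{F}^n$, and party $i$ receives the coordinate $\hat{\mathbf{s}}_i$. For $\mathcal{T} \subseteq \{1, \dots, n\}$, let $\hat{\mathbf{s}}_{\mathcal{T}}$ be the vector of shares of the parties in $\mathcal{T}$. The average leakage per symbol from a random vector $\mathbf{x}$ of $N \geq 1$ symbols of $\mathbb{F}$ to a random variable $\mathbf{y}$ is $\mathcal{L}(\mathbf{x} \to \mathbf{y}) = \frac{1}{N} I(\mathbf{x}; \mathbf{y}) \in [0, \infty]$, where the mutual information $I(\mathbf{x}; \mathbf{y})$ (in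 nats) is the Kullback--Leibler divergence of the joint law of $(\mathbf{x}, \mathbf{y})$ from the product of its marginals. **Lemma.** Let $m \geq 1$, and let $\mathbf{s}, \mathbf{s}'$ be random secrets in $\mathbb{F}^m$ on a common probability space, with an arbitrary joint distribution. Let them be shared among the same $n$ parties as $\hat{\mathbf{s}}, \hat{\mathbf{s}}'$ by two (possibly equal) nested coset coding schemes over $\mathbb{F}$, independently, i.e. with noise vectors $\mathbf{r}, \mathbf{r}'$ such that $(\mathbf{s}, \mathbf{s}')$, $\mathbf{r}$ and $\mathbf{r}'$ are mutually independent. Then for every $\mathcal{T} \subseteq \{1, \dots, n\}$, $$\mathcal{L}\big((\mathbf{s}, \mathbf{s}') \to (\hat{\mathbf{s}}_{\mathcal{T}}, \hat{\mathbf{s}}'_{\mathcal{T}})\big) \leq \max\{\mathcal{L}(\mathbf{s} \to \hat{\mathbf{s}}_{\mathcal{T}}),\ \mathcal{L}(\mathbf{s}' \to \hat{\mathbf{s}}'_{\mathcal{T}})\},$$ where $(\mathbf{s}, \mathbf{s}')$ is regarded as a vector of $2m$ symbols. -/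

import Mathlib

open MeasureTheory ProbabilityTheory
open scoped ENNReal

namespace SecretSharing

/-- A nested coset coding scheme over the field `F`, for secrets in `F ^ m`, noise vectors in
`F ^ k` and `n` parties: two generator matrices of full (row) rank whose row spaces intersect
trivially. -/
structure NestedCosetCodingScheme (F : Type*) [Field F] (m k n : ℕ) where
  /-- the generator matrix that encodes the secret -/
  Genc : Matrix (Fin m) (Fin n) F
  /-- the generator matrix that encodes the noise -/
  Gsec : Matrix (Fin k) (Fin n) F
  rank_Genc : Genc.rank = m
  rank_Gsec : Gsec.rank = k
  disjoint_rowSpaces : Disjoint (Submodule.span F (Set.range Genc.row))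
    (Submodule.span F (Set.range Gsec.row))

/-- The vector of all `n` shares `s * Genc + r * Gsec` of the secret `s` with noise `r`;
party `i` receives the coordinate `i`. -/
def NestedCosetCodingScheme.shares {F : Type*} [Field F] {m k n : ℕ}
    (C : NestedCosetCodingScheme F m k n) (s : Fin m → F) (r : Fin k → F) : Fin n → F :=
  Matrix.vecMul s C.Genc + Matrix.vecMul r C.Gsec

/-- The shares held by the parties in `T`. -/
def NestedCosetCodingScheme.sharesOn {F : Type*} [Field F] {m k n : ℕ}
    (C : NestedCosetCodingScheme F m k n) (T : Finset (Fin n))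
    (s : Fin m → F) (r : Fin k → F) : T → F :=
  fun i => C.shares s r i

/-- The mutual information `I(X; Y)` in nats: the Kullback-Leibler divergence of the joint law
from the product of the marginal laws. It may be infinite. -/
noncomputable def mutualInformation {Ω α β : Type*} [MeasurableSpace Ω] [MeasurableSpace α]
    [MeasurableSpace β] (X : Ω → α) (Y : Ω → β) (P : Measure Ω) : ℝ≥0∞ :=
  InformationTheory.klDiv (P.map (fun ω => (X ω, Y ω))) ((P.map X).prod (P.map Y))

/-- The average leakage per input symbol from a random secret `X`, a vector of symbols in `F`
indexed by `ι`, to an observation `Y`: the mutual information divided by the number of symbols. -/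
noncomputable def averageLeakage {Ω ι F β : Type*} [MeasurableSpace Ω] [Fintype ι]
    [MeasurableSpace F] [MeasurableSpace β] (X : Ω → ι → F) (Y : Ω → β) (P : Measure Ω) : ℝ≥0∞ :=
  mutualInformation X Y P / (Fintype.card ι : ℝ≥0∞)

end SecretSharing

/-! Each share vector is a function of its secret and of fresh noise, so given the pair of secrets
the two observations are outputs of independent channels. Measure their joint law against the
product `q.prod q'` of the output marginals: by the chain rule for divergence this costs at most the
sum of the two single mutual informations (`klDiv_compProd_prod_le`). The secrets may be correlated,
so the true output law need not be that product, but using the true law only lowers the divergence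
(`klDiv_prod_snd_le`). Hence the joint information is at most the sum, and dividing by `2m` bounds
it by the average of the two leakages, thus by their maximum. Only data processing and the chain
rule are used, with no subtraction, so infinite values need no special care. -/

namespace SecretSharing

/-! ### Divergence between channels -/

section Divergence

open InformationTheory

variable {α α' β β' γ : Type*} [MeasurableSpace α] [MeasurableSpace α'] [MeasurableSpace β]
  [MeasurableSpace β'] [MeasurableSpace γ]

/-- For every channel `κ`, one and the same kernel turns the joint law of `g x` and the output of
`κ` into the joint law of `x` and that output: it samples `x` given `g x`. -/
theorem exists_kernel_comp_eq_compProd_comap [StandardBorelSpace α] (σ : Measure α)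
    [IsProbabilityMeasure σ] {g : α → γ} (hg : Measurable g) :
    ∃ c : Kernel (γ × β) (α × β), IsMarkovKernel c ∧ ∀ (κ : Kernel γ β) [IsMarkovKernel κ],
      c ∘ₘ (σ.map g ⊗ₘ κ) = σ ⊗ₘ κ.comap g hg := by
  have : Nonempty α := σ.nonempty_of_neZero
  let τ : Measure (γ × α) := σ.map (fun x => (g x, x))
  have hτm : Measurable fun x => (g x, x) := hg.prodMk measurable_id
  have : IsProbabilityMeasure τ := Measure.isProbabilityMeasure_map hτm.aemeasurable
  have hfst : τ.fst = σ.map g := by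
    rw [Measure.fst, Measure.map_map measurable_fst hτm]; rfl
  have hτ : σ.map g ⊗ₘ τ.condKernel = τ := by rw [← hfst]; exact τ.disintegrate τ.condKernel
  have : IsProbabilityMeasure (σ.map g) := Measure.isProbabilityMeasure_map hg.aemeasurable
  -- Resample `x` from `g x` and keep the output; `κ` does not enter.
  refine ⟨(τ.condKernel.comap Prod.fst measurable_fst) ×ₖ
    (Kernel.deterministic Prod.snd measurable_snd), inferInstance, fun κ _ => ?_⟩
  refine Measure.ext_of_lintegral _ fun f hf => ?_
  have hf' : Measurable fun p : γ × β => ∫⁻ x, f (x, p.2) ∂τ.condKernel p.1 :=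
    Measurable.lintegral_kernel_prod_right (κ := τ.condKernel.comap Prod.fst measurable_fst)
      (f := fun (p : γ × β) (x : α) => f (x, p.2)) (by fun_prop)
  have hf'' : Measurable fun p : γ × α => ∫⁻ y, f (p.2, y) ∂κ p.1 :=
    Measurable.lintegral_kernel_prod_right (κ := κ.comap Prod.fst measurable_fst)
      (f := fun (p : γ × α) (y : β) => f (p.2, y)) (by fun_prop)
  rw [Measure.lintegral_bind (Kernel.aemeasurable _) hf.aemeasurable]
  calc _ = ∫⁻ p, ∫⁻ x, f (x, p.2) ∂τ.condKernel p.1 ∂(σ.map g ⊗ₘ κ) := by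
        refine lintegral_congr fun p => ?_
        rw [Kernel.lintegral_prod _ _ _ hf]
        refine lintegral_congr fun x => ?_
        rw [Kernel.lintegral_deterministic' _ (by fun_prop)]
    _ = ∫⁻ z, ∫⁻ y, ∫⁻ x, f (x, y) ∂τ.condKernel z ∂κ z ∂(σ.map g) :=
        Measure.lintegral_compProd hf'
    -- Given `z = g x`, the input and the output are independent, so Tonelli swaps the sampling
    -- order.
    _ = ∫⁻ z, ∫⁻ x, ∫⁻ y, f (x, y) ∂κ z ∂τ.condKernel z ∂(σ.map g) :=
        lintegral_congr fun z => lintegral_lintegral_swap (by fun_prop)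
    _ = ∫⁻ p, ∫⁻ y, f (p.2, y) ∂κ p.1 ∂(σ.map g ⊗ₘ τ.condKernel) :=
        (Measure.lintegral_compProd hf'').symm
    _ = ∫⁻ x, ∫⁻ y, f (x, y) ∂κ (g x) ∂σ := by
        rw [hτ, lintegral_map hf'' hτm]
    _ = _ := by rw [Measure.lintegral_compProd hf]; rfl

/-- If two channels read their input `x` only through `g x`, then the divergence between them,
given `x`, is at most the divergence given `g x`. -/
theorem klDiv_compProd_comap_le [StandardBorelSpace α] (σ : Measure α)
    [IsProbabilityMeasure σ] {g : α → γ} (hg : Measurable g) (κ η : Kernel γ β)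
    [IsMarkovKernel κ] [IsMarkovKernel η] :
    klDiv (σ ⊗ₘ κ.comap g hg) (σ ⊗ₘ η.comap g hg) ≤ klDiv (σ.map g ⊗ₘ κ) (σ.map g ⊗ₘ η) := by
  obtain ⟨c, _, hc⟩ := exists_kernel_comp_eq_compProd_comap (β := β) σ hg
  have : IsProbabilityMeasure (σ.map g) := Measure.isProbabilityMeasure_map hg.aemeasurable
  rw [← hc κ, ← hc η]
  exact klDiv_comp_right_le _ _ c

/-- Sampling the two outputs one after the other puts them in the form required by the chain rule.
-/
theorem compProd_prod_eq_map_compProd_compProd (σ : Measure α) [IsProbabilityMeasure σ]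
    (κ : Kernel α β) (κ' : Kernel α β') [IsMarkovKernel κ] [IsMarkovKernel κ'] :
    σ ⊗ₘ (κ ×ₖ κ') = ((σ ⊗ₘ κ) ⊗ₘ κ'.comap Prod.fst measurable_fst).map
      (fun p => (p.1.1, p.1.2, p.2)) := by
  refine Measure.ext_of_lintegral _ fun f hf => ?_
  rw [lintegral_map hf (by fun_prop), Measure.lintegral_compProd hf,
    Measure.lintegral_compProd (by fun_prop), Measure.lintegral_compProd]
  · refine lintegral_congr fun x => ?_
    rw [Kernel.lintegral_prod _ _ _ (by fun_prop)]
    rfl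
  · exact Measurable.lintegral_kernel_prod_right
      (κ := κ'.comap Prod.fst measurable_fst)
      (f := fun (p : α × β) (y : β') => f (p.1, p.2, y)) (by fun_prop)

/-- Tensorization: two conditionally independent channels, each fed by one component of the input,
have a divergence from product output at most the sum of the two divergences. -/
theorem klDiv_compProd_prod_le [StandardBorelSpace α] [StandardBorelSpace α']
    [StandardBorelSpace β] (σ : Measure (α × α')) [IsProbabilityMeasure σ]
    (κ η : Kernel α β) (κ' η' : Kernel α' β') [IsMarkovKernel κ] [IsMarkovKernel η]
    [IsMarkovKernel κ'] [IsMarkovKernel η'] :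
    klDiv (σ ⊗ₘ (κ.comap Prod.fst measurable_fst ×ₖ κ'.comap Prod.snd measurable_snd))
        (σ ⊗ₘ (η.comap Prod.fst measurable_fst ×ₖ η'.comap Prod.snd measurable_snd))
      ≤ klDiv (σ.fst ⊗ₘ κ) (σ.fst ⊗ₘ η) + klDiv (σ.snd ⊗ₘ κ') (σ.snd ⊗ₘ η') := by
  rw [compProd_prod_eq_map_compProd_compProd, compProd_prod_eq_map_compProd_compProd]
  refine (klDiv_map_le _ _ (by fun_prop)).trans ?_
  rw [klDiv_compProd_eq_add]
  refine add_le_add (klDiv_compProd_comap_le σ measurable_fst κ η) ?_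
  -- The second chain rule term has base `σ ⊗ₘ κ`, but `κ'` and `η'` read only the `α'` component,
  -- whose law is `σ.snd`.
  have h := klDiv_compProd_comap_le (σ ⊗ₘ κ.comap Prod.fst measurable_fst)
    (measurable_snd.comp measurable_fst) κ' η'
  rwa [← Measure.map_map measurable_snd measurable_fst, ← Measure.fst, Measure.fst_compProd] at h

/-- Among all product measures with a given first marginal `ρ`, the one with the true second
marginal has the least divergence. -/
theorem klDiv_prod_snd_le [StandardBorelSpace α] (τ : Measure (α × β)) [IsProbabilityMeasure τ]
    (ρ : Measure α) [IsProbabilityMeasure ρ] (ν : Measure β) [IsProbabilityMeasure ν] :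
    klDiv τ (ρ.prod τ.snd) ≤ klDiv τ (ρ.prod ν) := by
  have : Nonempty α := ρ.nonempty_of_neZero
  -- Swapping makes the `β` marginal the base of the disintegration.
  let τ' := τ.map Prod.swap
  have : IsProbabilityMeasure τ' := Measure.isProbabilityMeasure_map measurable_swap.aemeasurable
  have hfst : τ'.fst = τ.snd := Measure.fst_map_swap
  have hdis : τ.snd ⊗ₘ τ'.condKernel = τ' := by rw [← hfst]; exact τ'.disintegrate τ'.condKernel
  have hτ : τ = τ'.map Prod.swap := by
    rw [Measure.map_map measurable_swap measurable_swap]; simp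
  calc klDiv τ (ρ.prod τ.snd) = klDiv (τ'.map Prod.swap) ((τ.snd.prod ρ).map Prod.swap) := by
        rw [← hτ, Measure.prod_swap]
    _ ≤ klDiv τ' (τ.snd.prod ρ) := klDiv_map_le _ _ measurable_swap
    _ = klDiv (τ.snd ⊗ₘ τ'.condKernel) (τ.snd ⊗ₘ Kernel.const β ρ) := by
        rw [hdis, Measure.compProd_const]
    _ ≤ klDiv (τ.snd ⊗ₘ τ'.condKernel) (ν ⊗ₘ Kernel.const β ρ) := by
        -- The term dropped next is the divergence of `τ.snd` from `ν`.
        rw [klDiv_compProd_eq_add τ.snd ν]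
        exact le_add_self
    _ = klDiv (τ.map Prod.swap) ((ρ.prod ν).map Prod.swap) := by
        rw [hdis, Measure.compProd_const, Measure.prod_swap]
    _ ≤ klDiv τ (ρ.prod ν) := klDiv_map_le _ _ measurable_swap

end Divergence

/-! ### Mutual information across noisy channels -/

section MutualInformation

open InformationTheory

variable {Ω α α' β β' γ γ' : Type*} [MeasurableSpace Ω] [MeasurableSpace α] [MeasurableSpace α']
  [MeasurableSpace β] [MeasurableSpace β'] [MeasurableSpace γ] [MeasurableSpace γ']

/-- The channel that applies `f` to its input and an independent noise with law `ν`. -/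
noncomputable def noiseKernel (f : α × γ → β) (ν : Measure γ) : Kernel α β :=
  (Kernel.id ×ₖ Kernel.const α ν).map f

theorem isMarkovKernel_noiseKernel {f : α × γ → β} (hf : Measurable f) (ν : Measure γ)
    [IsProbabilityMeasure ν] : IsMarkovKernel (noiseKernel f ν) :=
  Kernel.IsMarkovKernel.map _ hf

theorem lintegral_noiseKernel {f : α × γ → β} (hf : Measurable f) (ν : Measure γ)
    [IsProbabilityMeasure ν] (x : α) {h : β → ℝ≥0∞} (hh : Measurable h) :
    ∫⁻ y, h y ∂noiseKernel f ν x = ∫⁻ z, h (f (x, z)) ∂ν := by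
  rw [noiseKernel, Kernel.lintegral_map _ hf _ hh, Kernel.lintegral_prod _ _ _ (by fun_prop),
    Kernel.lintegral_id' (by fun_prop)]
  rfl

theorem map_prodMk_eq_compProd_noiseKernel (P : Measure Ω) [IsProbabilityMeasure P] {X : Ω → α}
    {R : Ω → γ} (hX : Measurable X) (hR : Measurable R) (hXR : IndepFun X R P)
    {f : α × γ → β} (hf : Measurable f) :
    P.map (fun ω => (X ω, f (X ω, R ω))) = P.map X ⊗ₘ noiseKernel f (P.map R) := by
  have := Measure.isProbabilityMeasure_map (μ := P) hX.aemeasurable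
  have := Measure.isProbabilityMeasure_map (μ := P) hR.aemeasurable
  have := isMarkovKernel_noiseKernel hf (P.map R)
  refine Measure.ext_of_lintegral _ fun h hh => ?_
  have hprod := (indepFun_iff_map_prod_eq_prod_map_map hX.aemeasurable hR.aemeasurable).1 hXR
  rw [Measure.lintegral_compProd hh]
  have hinner (x : α) : ∫⁻ y, h (x, y) ∂noiseKernel f (P.map R) x
      = ∫⁻ z, h (x, f (x, z)) ∂P.map R := lintegral_noiseKernel hf _ x
      (h := fun y => h (x, y)) (by fun_prop)
  simp_rw [hinner]
  calc _ = ∫⁻ ω, h (X ω, f (X ω, R ω)) ∂P := lintegral_map hh (by fun_prop)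
    _ = ∫⁻ p : α × γ, h (p.1, f p) ∂P.map (fun ω => (X ω, R ω)) :=
        (lintegral_map (f := fun p : α × γ => h (p.1, f p)) (by fun_prop)
          (hX.prodMk hR)).symm
    _ = _ := by
        rw [hprod]
        exact lintegral_prod (fun p : α × γ => h (p.1, f p)) (by fun_prop)

theorem noiseKernel_prodMap {f : α × γ → β} (hf : Measurable f) {f' : α' × γ' → β'}
    (hf' : Measurable f') (ν : Measure γ) [IsProbabilityMeasure ν] (ν' : Measure γ')
    [IsProbabilityMeasure ν'] :
    noiseKernel (fun p : (α × α') × (γ × γ') => (f (p.1.1, p.2.1), f' (p.1.2, p.2.2)))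
        (ν.prod ν')
      = (noiseKernel f ν).comap Prod.fst measurable_fst
        ×ₖ (noiseKernel f' ν').comap Prod.snd measurable_snd := by
  have := isMarkovKernel_noiseKernel hf ν
  have := isMarkovKernel_noiseKernel hf' ν'
  ext1 x
  refine Measure.ext_of_lintegral _ fun h hh => ?_
  rw [lintegral_noiseKernel (by fun_prop) _ _ hh, Kernel.lintegral_prod _ _ _ hh]
  simp_rw [Kernel.comap_apply]
  rw [lintegral_noiseKernel hf _ _ (hh.lintegral_prod_right'), lintegral_prod _ (by fun_prop)]
  refine lintegral_congr fun z => ?_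
  rw [lintegral_noiseKernel hf' _ _ (by fun_prop)]

/-- Independence of the output from the input corresponds to a constant channel, so mutual
information becomes a divergence between two channels. -/
theorem mutualInformation_eq_klDiv_compProd (P : Measure Ω) [IsProbabilityMeasure P] {X : Ω → α}
    {R : Ω → γ} (hX : Measurable X) (hR : Measurable R) (hXR : IndepFun X R P)
    {f : α × γ → β} (hf : Measurable f) :
    mutualInformation X (fun ω => f (X ω, R ω)) P
      = klDiv (P.map X ⊗ₘ noiseKernel f (P.map R))
          (P.map X ⊗ₘ Kernel.const α (P.map fun ω => f (X ω, R ω))) := by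
  rw [mutualInformation, map_prodMk_eq_compProd_noiseKernel P hX hR hXR hf, Measure.compProd_const]

/-- The mutual information between a pair of inputs and the two outputs of independent noisy
channels is at most the sum of the individual ones. -/
theorem mutualInformation_prodMk_le_add [StandardBorelSpace α] [StandardBorelSpace α']
    [StandardBorelSpace β] (P : Measure Ω) [IsProbabilityMeasure P]
    {X : Ω → α} {X' : Ω → α'} {R : Ω → γ} {R' : Ω → γ'}
    (hX : Measurable X) (hX' : Measurable X') (hR : Measurable R) (hR' : Measurable R')
    (hRR' : IndepFun R R' P)
    (hXR : IndepFun (fun ω => (X ω, X' ω)) (fun ω => (R ω, R' ω)) P)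
    {f : α × γ → β} (hf : Measurable f) {f' : α' × γ' → β'} (hf' : Measurable f') :
    mutualInformation (fun ω => (X ω, X' ω)) (fun ω => (f (X ω, R ω), f' (X' ω, R' ω))) P
      ≤ mutualInformation X (fun ω => f (X ω, R ω)) P
        + mutualInformation X' (fun ω => f' (X' ω, R' ω)) P := by
  have := Measure.isProbabilityMeasure_map (μ := P) hR.aemeasurable
  have := Measure.isProbabilityMeasure_map (μ := P) hR'.aemeasurable
  have hY : Measurable fun ω => f (X ω, R ω) := by fun_prop
  have hY' : Measurable fun ω => f' (X' ω, R' ω) := by fun_prop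
  have hXX' : Measurable fun ω => (X ω, X' ω) := by fun_prop
  have := Measure.isProbabilityMeasure_map (μ := P) hY.aemeasurable
  have := Measure.isProbabilityMeasure_map (μ := P) hY'.aemeasurable
  have := Measure.isProbabilityMeasure_map (μ := P) hXX'.aemeasurable
  have := isMarkovKernel_noiseKernel hf (P.map R)
  have := isMarkovKernel_noiseKernel hf' (P.map R')
  set q := P.map fun ω => f (X ω, R ω)
  set q' := P.map fun ω => f' (X' ω, R' ω)
  set σ := P.map fun ω => (X ω, X' ω) with hσ
  have hfst : σ.fst = P.map X := Measure.fst_map_prodMk hX'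
  have hsnd : σ.snd = P.map X' := Measure.snd_map_prodMk hX
  let τ := P.map fun ω => ((X ω, X' ω), (f (X ω, R ω), f' (X' ω, R' ω)))
  have : IsProbabilityMeasure τ := Measure.isProbabilityMeasure_map (by fun_prop)
  have hτ : τ = σ ⊗ₘ ((noiseKernel f (P.map R)).comap Prod.fst measurable_fst
      ×ₖ (noiseKernel f' (P.map R')).comap Prod.snd measurable_snd) := by
    rw [← noiseKernel_prodMap hf hf', ← (indepFun_iff_map_prod_eq_prod_map_map
      hR.aemeasurable hR'.aemeasurable).1 hRR']
    exact map_prodMk_eq_compProd_noiseKernel P hXX' (hR.prodMk hR') hXR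
      (f := fun p : (α × α') × (γ × γ') => (f (p.1.1, p.2.1), f' (p.1.2, p.2.2))) (by fun_prop)
  have hτsnd : τ.snd = P.map fun ω => (f (X ω, R ω), f' (X' ω, R' ω)) :=
    Measure.snd_map_prodMk hXX'
  have hconst : σ.prod (q.prod q') = σ ⊗ₘ ((Kernel.const α q).comap Prod.fst measurable_fst
      ×ₖ (Kernel.const α' q').comap Prod.snd measurable_snd) := by
    rw [← Measure.compProd_const]
    congr 1
    ext1 x
    rw [Kernel.prod_apply]
    rfl
  calc _ = klDiv τ (σ.prod τ.snd) := by rw [hτsnd]; rfl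
    _ ≤ klDiv τ (σ.prod (q.prod q')) := klDiv_prod_snd_le τ σ _
    _ ≤ klDiv (σ.fst ⊗ₘ noiseKernel f (P.map R)) (σ.fst ⊗ₘ Kernel.const α q)
        + klDiv (σ.snd ⊗ₘ noiseKernel f' (P.map R')) (σ.snd ⊗ₘ Kernel.const α' q') := by
        rw [hτ, hconst]
        exact klDiv_compProd_prod_le σ _ _ _ _
    _ = _ := by
        rw [hfst, hsnd, mutualInformation_eq_klDiv_compProd P hX hR
            (hXR.comp measurable_fst measurable_fst) hf,
          mutualInformation_eq_klDiv_compProd P hX' hR'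
            (hXR.comp measurable_snd measurable_snd) hf']

theorem mutualInformation_comp_left_le (P : Measure Ω) [IsProbabilityMeasure P] {X : Ω → α}
    {Y : Ω → β} (hX : Measurable X) (hY : Measurable Y) {g : α → γ} (hg : Measurable g) :
    mutualInformation (fun ω => g (X ω)) Y P ≤ mutualInformation X Y P := by
  have := Measure.isProbabilityMeasure_map (μ := P) hX.aemeasurable
  have := Measure.isProbabilityMeasure_map (μ := P) hY.aemeasurable
  have hgid : Measurable (Prod.map g (id : β → β)) := hg.prodMap measurable_id
  have h := klDiv_map_le (P.map fun ω => (X ω, Y ω)) ((P.map X).prod (P.map Y)) hgid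
  rw [← Measure.map_prod_map _ _ hg measurable_id, Measure.map_id, Measure.map_map hg hX,
    Measure.map_map hgid (hX.prodMk hY)] at h
  exact h

end MutualInformation

/-! ### Shares and averaging per symbol -/

theorem NestedCosetCodingScheme.measurable_sharesOn {F : Type*} [Field F] [MeasurableSpace F]
    [MeasurableAdd₂ F] [MeasurableMul₂ F] {m k n : ℕ} (C : NestedCosetCodingScheme F m k n)
    (T : Finset (Fin n)) :
    Measurable fun p : (Fin m → F) × (Fin k → F) => C.sharesOn T p.1 p.2 := by
  refine measurable_pi_lambda _ fun i => ?_
  simp only [sharesOn, shares, Pi.add_apply, Matrix.vecMul, dotProduct]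
  fun_prop

theorem measurable_sumElim {F : Type*} [MeasurableSpace F] {ι ι' : Type*} :
    Measurable fun p : (ι → F) × (ι' → F) => (Sum.elim p.1 p.2 : ι ⊕ ι' → F) := by
  refine measurable_pi_lambda _ fun i => ?_
  cases i <;> simp only [Sum.elim_inl, Sum.elim_inr] <;> fun_prop

theorem add_div_two_mul_le_max (a b : ℝ≥0∞) (m : ℕ) :
    (a + b) / ((m + m : ℕ) : ℝ≥0∞) ≤ max (a / m) (b / m) := by
  have h : a + b ≤ 2 * max a b := by
    rw [two_mul]; exact add_le_add (le_max_left _ _) (le_max_right _ _)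
  calc (a + b) / ((m + m : ℕ) : ℝ≥0∞) ≤ 2 * max a b / (2 * m) := by
        rw [← two_mul]; push_cast; gcongr
    _ = max a b / m := ENNReal.mul_div_mul_left _ _ two_ne_zero ENNReal.ofNat_ne_top
    _ ≤ _ := by
        rcases le_total a b with h | h
        · rw [max_eq_right h]; exact le_max_right _ _
        · rw [max_eq_left h]; exact le_max_left _ _

end SecretSharing

theorem mainTheorem6 {F : Type*} [Field F] [MeasurableSpace F] [StandardBorelSpace F]
    [MeasurableAdd₂ F] [MeasurableMul₂ F]
    {Ω : Type*} [MeasurableSpace Ω] (P : Measure Ω) [IsProbabilityMeasure P]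
    {m k k' n : ℕ} (hm : 0 < m)
    (C : SecretSharing.NestedCosetCodingScheme F m k n)
    (C' : SecretSharing.NestedCosetCodingScheme F m k' n)
    (s s' : Ω → Fin m → F) (r : Ω → Fin k → F) (r' : Ω → Fin k' → F)
    (hs : Measurable s) (hs' : Measurable s') (hr : Measurable r) (hr' : Measurable r')
    -- the secrets may depend on each other; the pair of secrets and the two noise vectors
    -- are mutually independent
    (hnoise : IndepFun r r' P)
    (hsecret : IndepFun (fun ω => (s ω, s' ω)) (fun ω => (r ω, r' ω)) P)
    (T : Finset (Fin n)) :
    SecretSharing.averageLeakage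
        (fun ω => (Sum.elim (s ω) (s' ω) : Fin m ⊕ Fin m → F))
        (fun ω => (C.sharesOn T (s ω) (r ω), C'.sharesOn T (s' ω) (r' ω))) P
      ≤ max
        (SecretSharing.averageLeakage s (fun ω => C.sharesOn T (s ω) (r ω)) P)
        (SecretSharing.averageLeakage s' (fun ω => C'.sharesOn T (s' ω) (r' ω)) P) := by
  have hf := C.measurable_sharesOn T
  have hf' := C'.measurable_sharesOn T
  -- Concatenating the two secrets into one vector is a measurable map of the pair, so data
  -- processing applies.
  have h := (SecretSharing.mutualInformation_comp_left_le P (hs.prodMk hs')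
    (Y := fun ω => (C.sharesOn T (s ω) (r ω), C'.sharesOn T (s' ω) (r' ω)))
    ((hf.comp (hs.prodMk hr)).prodMk (hf'.comp (hs'.prodMk hr')))
    SecretSharing.measurable_sumElim).trans
    (SecretSharing.mutualInformation_prodMk_le_add P hs hs' hr hr' hnoise hsecret hf hf')
  simp only [SecretSharing.averageLeakage, Fintype.card_sum, Fintype.card_fin]
  exact (ENNReal.div_le_div_right h _).trans (SecretSharing.add_div_two_mul_le_max _ _ m)
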